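/- Graphs are finite multigraphs $G=(V,E,\phi)$; loops and parallel edges are allowed. For $C\subseteq E$ let $G\langle C\rangle$ be the subgraph with edge set $C$ whose vertices are the ends of the edges in $C$. The bicircular matroid $M_1(G)$ is the matroid on $E$ whose circuits are the sets $C\subseteq E$ such that $|C|-|V(G\langle C\rangle)|=1$ and $G\langle C\rangle$ has no isolated vertex, no leaf (vertex of degree $1$) and no component that is a cycle. A graph is 3-connected if it is simple, has at least four vertices, and remains connected after the deletion of any set of at most two vertices. Two graphs $G=(V,E,\phi)$ and $G'=(V',E,\phi')$ with the same edge set are strongly isomorphic if there is a bijection $\nu:V\to V'$ such that for all $e\in E$ and $x,y\in V$: $\phi(e)=\{x,y\}$ if and only if $\phi'(e)=\{\nu(x),\nu(y)\}$. Theorem. Let $G$ be a 3-connected graph that is not isomorphic to the complete graph $K_4$. Then $G$ is uniquely defined by its bicircular matroid: if $G'$ is a graph without isolated vertices and $M_1(G')=M_1(G)$, then $G$ and $G'$ are strongly isomorphic. -/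

import Mathlib

open scoped Graph

namespace Graph

/-- The degree of a vertex of a multigraph: every incident edge counts once, every loop twice. -/
noncomputable def deg {α β : Type*} (G : Graph α β) (x : α) : ℕ∞ :=
  (G.incidenceSet x).encard + (G.loopSet x).encard

/-- `G` has no isolated vertex: every vertex is incident to some edge. -/
def NoIsolated {α β : Type*} (G : Graph α β) : Prop :=
  ∀ x ∈ V(G), (G.incidenceSet x).Nonempty

/-- `G⟨X⟩`: the edges are those of `X`, the vertices are the ends of these edges. -/
def edgeInduce {α β : Type*} (G : Graph α β) (X : Set β) : Graph α β :=
  (G.restrict X).induce {x | ∃ e ∈ X, G.Inc e x}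

/-- `Δ(G) = |E(G)| - |V(G)|` (for finite graphs). -/
noncomputable def excess {α β : Type*} (G : Graph α β) : ℤ :=
  (E(G).ncard : ℤ) - (V(G).ncard : ℤ)

/-- A (finite) graph is a cacti-graph if it has no isolated vertices, no leaves and no component
that is a cycle. A component of a finite multigraph is a cycle when all its vertices have degree
two; a loop and a pair of parallel edges are cycles. -/
structure IsCactiGraph {α β : Type*} (G : Graph α β) : Prop where
  noIsolated : G.NoIsolated
  noLeaf : ∀ x ∈ V(G), G.deg x ≠ 1
  noCycleComponent : ∀ c : G.toSimpleGraph.ConnectedComponent, ¬ ∀ x ∈ c.supp, G.deg x = 2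

/-- `C_k(G)`: the finite edge sets `C` such that `G⟨C⟩` is a cacti-graph with
`|C| - |V(G⟨C⟩)| = k`. -/
def circularSets {α β : Type*} (G : Graph α β) (k : ℕ) : Set (Set β) :=
  {C | C ⊆ E(G) ∧ C.Finite ∧ (G.edgeInduce C).excess = k ∧ (G.edgeInduce C).IsCactiGraph}

/-- The set of ends of the edges in `X`, i.e. the vertex set of `G⟨X⟩`. -/
def ends {α β : Type*} (G : Graph α β) (X : Set β) : Set α := {x | ∃ e ∈ X, G.Inc e x}

lemma ends_mono {α β : Type*} (G : Graph α β) {X Y : Set β} (h : X ⊆ Y) :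
    G.ends X ⊆ G.ends Y := fun _ ⟨e, he, hx⟩ ↦ ⟨e, h he, hx⟩

lemma ends_finite {α β : Type*} (G : Graph α β) {X : Set β} (h : X.Finite) :
    (G.ends X).Finite := by
  have : G.ends X = ⋃ e ∈ X, {x | G.Inc e x} := by
    ext x; simp [ends]
  rw [this]
  refine h.biUnion fun e _ ↦ ?_
  by_cases he : e ∈ E(G)
  · obtain ⟨a, b, hab⟩ := G.exists_isLink_of_mem_edgeSet he
    exact (Set.toFinite {a, b}).subset fun x hx ↦ by
      simpa using Inc.eq_or_eq_of_isLink hx hab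
  · simp [he]

lemma ends_union {α β : Type*} (G : Graph α β) (X Y : Set β) :
    G.ends (X ∪ Y) = G.ends X ∪ G.ends Y := by
  ext x; simp [ends, or_and_right, exists_or]

@[simp] lemma vertexSet_edgeInduce {α β : Type*} (G : Graph α β) (X : Set β) :
    V(G.edgeInduce X) = G.ends X := rfl

lemma edgeInduce_isLink {α β : Type*} {G : Graph α β} {X : Set β} {e : β} {x y : α} :
    (G.edgeInduce X).IsLink e x y ↔ e ∈ X ∧ G.IsLink e x y := by
  simp only [edgeInduce, induce_isLink, restrict_isLink, Set.mem_ofPred_eq]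
  exact ⟨fun h ↦ h.1, fun h ↦ ⟨h, ⟨e, h.1, h.2.inc_left⟩, ⟨e, h.1, h.2.inc_right⟩⟩⟩

lemma edgeInduce_inc {α β : Type*} {G : Graph α β} {X : Set β} {e : β} {x : α} :
    (G.edgeInduce X).Inc e x ↔ e ∈ X ∧ G.Inc e x := by
  simp [Inc, edgeInduce_isLink]

lemma edgeSet_edgeInduce {α β : Type*} {G : Graph α β} {X : Set β} (h : X ⊆ E(G)) :
    E(G.edgeInduce X) = X := by
  ext e
  rw [edge_mem_iff_exists_isLink]
  simp only [edgeInduce_isLink, exists_and_left]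
  exact ⟨fun h ↦ h.1, fun he ↦ ⟨he, G.exists_isLink_of_mem_edgeSet (h he)⟩⟩

/-- A set of vertices of degree at most two carries at most as many edges as vertices. -/
lemma ncard_le_of_deg_eq_two {α β : Type*} (H : Graph α β) {K : Set β} {U : Set α}
    (hK : K.Finite) (hU : U.Finite) (hdeg : ∀ x ∈ U, H.deg x = 2)
    (hends : ∀ e ∈ K, ∃ x ∈ U, ∃ y ∈ U, H.IsLink e x y) : K.ncard ≤ U.ncard := by
  classical
  lift K to Finset β using hK
  lift U to Finset α using hU
  rw [Set.ncard_coe_finset, Set.ncard_coe_finset]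
  have h1 : ∑ x ∈ U, ∑ e ∈ K, ((if H.Inc e x then 1 else 0) + (if H.IsLoopAt e x then 1 else 0))
      ≤ ∑ x ∈ U, 2 := by
    refine Finset.sum_le_sum fun x hx ↦ ?_
    rw [Finset.sum_add_distrib, ← Finset.card_filter, ← Finset.card_filter]
    have h := hdeg x (by simpa using hx)
    have ha : ((K.filter fun e ↦ H.Inc e x).card : ℕ∞) ≤ (H.incidenceSet x).encard := by
      rw [← Set.encard_coe_eq_coe_finsetCard]
      exact Set.encard_le_encard fun e he ↦ by simpa using (Finset.mem_filter.1 he).2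
    have hb : ((K.filter fun e ↦ H.IsLoopAt e x).card : ℕ∞) ≤ (H.loopSet x).encard := by
      rw [← Set.encard_coe_eq_coe_finsetCard]
      exact Set.encard_le_encard fun e he ↦ by simpa using (Finset.mem_filter.1 he).2
    have := (add_le_add ha hb).trans_eq h
    exact_mod_cast this
  have h2 : ∑ e ∈ K, 2 ≤
      ∑ e ∈ K, ∑ x ∈ U, ((if H.Inc e x then 1 else 0) + (if H.IsLoopAt e x then 1 else 0)) := by
    refine Finset.sum_le_sum fun e he ↦ ?_
    obtain ⟨x, hx, y, hy, hxy⟩ := hends e (by simpa using he)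
    rw [Finset.sum_add_distrib, ← Finset.card_filter, ← Finset.card_filter]
    have hxm : x ∈ U.filter fun x ↦ H.Inc e x := by
      simpa using ⟨hx, hxy.inc_left⟩
    have hym : y ∈ U.filter fun x ↦ H.Inc e x := by
      simpa using ⟨hy, hxy.inc_right⟩
    by_cases hne : x = y
    · subst hne
      have hl : x ∈ U.filter fun x ↦ H.IsLoopAt e x := by
        simpa using ⟨hx, hxy⟩
      have := Finset.card_pos.2 ⟨x, hxm⟩
      have := Finset.card_pos.2 ⟨x, hl⟩
      omega
    · have : 1 < (U.filter fun x ↦ H.Inc e x).card :=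
        Finset.one_lt_card.2 ⟨x, hxm, y, hym, hne⟩
      omega
  rw [Finset.sum_comm] at h1
  have := h2.trans h1
  simp at this
  omega

/-- A finite edge set that has more edges than ends, and is minimal so, is a member of `C_1(G)`. -/
lemma mem_circularSets_of_minimal {α β : Type*} (G : Graph α β) {J : Set β} (hJE : J ⊆ E(G))
    (hJ : J.Finite) (hlt : (G.ends J).ncard < J.ncard)
    (hmin : ∀ L ⊂ J, L.ncard ≤ (G.ends L).ncard) : J ∈ G.circularSets 1 := by
  have hfin := G.ends_finite hJ
  have hne : J.Nonempty := by
    rw [Set.nonempty_iff_ne_empty]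
    rintro rfl
    simp at hlt
  have hcard : J.ncard = (G.ends J).ncard + 1 := by
    obtain ⟨e, he⟩ := hne
    have h1 := hmin (J \ {e}) (Set.sdiff_singleton_ssubset.2 he)
    have h2 := Set.ncard_le_ncard (G.ends_mono (Set.sdiff_subset (s := J) (t := {e}))) hfin
    have h3 := Set.ncard_sdiff_singleton_add_one he hJ
    omega
  refine ⟨hJE, hJ, ?_, ?_, ?_, ?_⟩
  · rw [excess, edgeSet_edgeInduce hJE, vertexSet_edgeInduce]
    omega
  · rintro x ⟨e, he, hx⟩
    exact ⟨e, edgeInduce_inc.2 ⟨he, hx⟩⟩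
  · rintro x hx hdeg
    rw [vertexSet_edgeInduce] at hx
    obtain ⟨e, he, hex⟩ := id hx
    have hone : ((G.edgeInduce J).incidenceSet x).encard ≤ 1 := hdeg ▸ le_self_add
    rw [Set.encard_le_one_iff] at hone
    have hsub : G.ends (J \ {e}) ⊆ G.ends J \ {x} := by
      rintro y ⟨f, ⟨hf, hfe⟩, hy⟩
      refine ⟨⟨f, hf, hy⟩, ?_⟩
      rintro rfl
      exact hfe (hone f e (edgeInduce_inc.2 ⟨hf, hy⟩) (edgeInduce_inc.2 ⟨he, hex⟩))
    have h1 := hmin (J \ {e}) (Set.sdiff_singleton_ssubset.2 he)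
    have h2 := Set.ncard_le_ncard hsub hfin.sdiff
    have h3 := Set.ncard_sdiff_singleton_add_one he hJ
    have h4 := Set.ncard_sdiff_singleton_add_one hx hfin
    omega
  · intro c hc
    set U : Set α := Subtype.val '' c.supp with hUdef
    set K : Set β := {e ∈ J | ∃ x ∈ U, G.Inc e x} with hKdef
    have hUsub : U ⊆ G.ends J := by
      rintro _ ⟨x, -, rfl⟩
      exact x.2
    have hclosed : ∀ e ∈ J, ∀ x y, G.IsLink e x y → x ∈ U → y ∈ U := by
      rintro e he x y hxy ⟨x', hx', rfl⟩
      have hl : (G.edgeInduce J).IsLink e x' y := edgeInduce_isLink.2 ⟨he, hxy⟩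
      refine ⟨⟨y, hl.right_mem⟩, ?_, rfl⟩
      by_cases hxy' : x' = ⟨y, hl.right_mem⟩
      · rwa [← hxy']
      · have hadj : (G.edgeInduce J).toSimpleGraph.Adj x' ⟨y, hl.right_mem⟩ :=
          ⟨hxy', ⟨e, hl⟩⟩
        rw [SimpleGraph.ConnectedComponent.mem_supp_iff] at hx' ⊢
        rw [← hx']
        exact (SimpleGraph.ConnectedComponent.sound hadj.reachable).symm
    have hKfin : K.Finite := hJ.subset fun e he ↦ he.1
    have hle : K.ncard ≤ U.ncard := by
      refine ncard_le_of_deg_eq_two (G.edgeInduce J) hKfin (hfin.subset hUsub) ?_ ?_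
      · rintro _ ⟨x, hx, rfl⟩
        exact hc x hx
      · rintro e ⟨he, x, hx, y, hxy⟩
        exact ⟨x, hx, y, hclosed e he x y hxy hx, edgeInduce_isLink.2 ⟨he, hxy⟩⟩
    have hKne : K.Nonempty := by
      obtain ⟨x, hx⟩ := c.nonempty_supp
      obtain ⟨e, he, hex⟩ := x.2
      exact ⟨e, he, x, ⟨x, hx, rfl⟩, hex⟩
    have hss : J \ K ⊂ J := by
      refine ⟨Set.sdiff_subset, fun h ↦ ?_⟩
      obtain ⟨e, he⟩ := hKne
      exact (h he.1).2 he
    have hsub : G.ends (J \ K) ⊆ G.ends J \ U := by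
      rintro y ⟨f, ⟨hf, hfK⟩, hy⟩
      exact ⟨⟨f, hf, hy⟩, fun hyU ↦ hfK ⟨hf, y, hyU, hy⟩⟩
    have h1 := hmin _ hss
    have h2 := Set.ncard_le_ncard hsub hfin.sdiff
    have h3 := Set.ncard_sdiff_add_ncard_of_subset (fun e (he : e ∈ K) ↦ he.1) hJ
    have h4 := Set.ncard_sdiff_add_ncard_of_subset hUsub hfin
    omega

/-- An edge set contains no member of `C_1(G)` if and only if each of its finite subsets has at
most as many edges as ends. -/
lemma forall_circularSets_not_subset_iff {α β : Type*} (G : Graph α β) {I : Set β}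
    (hI : I ⊆ E(G)) :
    (∀ C ∈ G.circularSets 1, ¬ C ⊆ I) ↔ ∀ J ⊆ I, J.Finite → J.ncard ≤ (G.ends J).ncard := by
  constructor
  · intro h J hJI hJ
    by_contra! hlt
    obtain ⟨L, hLJ, hL⟩ := (hJ.finite_subsets.subset (fun L (hL : L ∈
      {L : Set β | L ⊆ J ∧ (G.ends L).ncard < L.ncard}) ↦ hL.1)).exists_le_minimal
        (show J ∈ {L : Set β | L ⊆ J ∧ (G.ends L).ncard < L.ncard} from ⟨subset_rfl, hlt⟩)
    refine h L (G.mem_circularSets_of_minimal ((hLJ.trans hJI).trans hI) (hJ.subset hLJ)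
      hL.prop.2 fun M hM ↦ ?_) (hLJ.trans hJI)
    by_contra! hlt'
    exact hM.2 (hL.2 ⟨hM.1.trans hLJ, hlt'⟩ hM.1)
  · rintro h C ⟨hCE, hCfin, hex, -⟩ hCI
    have := h C hCI hCfin
    rw [excess, edgeSet_edgeInduce hCE, vertexSet_edgeInduce] at hex
    omega

/-- The augmentation property. -/
lemma exists_augment {α β : Type*} (G : Graph α β) {I J : Set β} (hIfin : I.Finite)
    (hJfin : J.Finite) (hI : ∀ L ⊆ I, L.Finite → L.ncard ≤ (G.ends L).ncard)
    (hJ : ∀ L ⊆ J, L.Finite → L.ncard ≤ (G.ends L).ncard) (hlt : I.ncard < J.ncard) :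
    ∃ e ∈ J, e ∉ I ∧ ∀ L ⊆ insert e I, L.Finite → L.ncard ≤ (G.ends L).ncard := by
  by_contra! hcon
  -- take a maximal tight subset `T` of `I`
  obtain ⟨T, -, hT⟩ := (hIfin.finite_subsets.subset (fun L (hL : L ∈
      {L : Set β | L ⊆ I ∧ (G.ends L).ncard = L.ncard}) ↦ hL.1)).exists_le_maximal
        (show ∅ ∈ {L : Set β | L ⊆ I ∧ (G.ends L).ncard = L.ncard} by simp [ends])
  obtain ⟨⟨hTI, hTt⟩, hTmax⟩ := hT
  have hTfin := hIfin.subset hTI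
  have hall : ∀ e ∈ J \ I, G.ends {e} ⊆ G.ends T := by
    rintro e ⟨heJ, heI⟩
    obtain ⟨L, hL, hLfin, hLlt⟩ := hcon e heJ heI
    have heL : e ∈ L := by
      by_contra heL
      have := hI L (fun f hf ↦ (hL hf).resolve_left (by rintro rfl; exact heL hf)) hLfin
      omega
    have hSI : L \ {e} ⊆ I := fun f hf ↦ (hL hf.1).resolve_left hf.2
    have hS := hI _ hSI hLfin.sdiff
    have hc := Set.ncard_sdiff_singleton_add_one heL hLfin
    have hmono := G.ends_mono (Set.sdiff_subset (s := L) (t := {e}))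
    have hm := Set.ncard_le_ncard hmono (G.ends_finite hLfin)
    have heq : G.ends (L \ {e}) = G.ends L :=
      Set.eq_of_subset_of_ncard_le hmono (by omega) (G.ends_finite hLfin)
    -- the union of the tight sets is tight
    set S := L \ {e} with hSdef
    have hSfin : S.Finite := hLfin.sdiff
    have hST : S ∪ T ∈ {L : Set β | L ⊆ I ∧ (G.ends L).ncard = L.ncard} := by
      refine ⟨Set.union_subset hSI hTI, ?_⟩
      have h1 := Set.ncard_union_add_ncard_inter S T hSfin hTfin
      have h2 := Set.ncard_union_add_ncard_inter (G.ends S) (G.ends T)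
        (G.ends_finite hSfin) (G.ends_finite hTfin)
      have h3 := hI (S ∩ T) (Set.inter_subset_left.trans hSI) (hSfin.inter_of_left _)
      have h4 := Set.ncard_le_ncard (Set.subset_inter
        (G.ends_mono (Set.inter_subset_left (s := S) (t := T)))
        (G.ends_mono (Set.inter_subset_right (s := S) (t := T))))
        ((G.ends_finite hSfin).inter_of_left _)
      have h5 := hI (S ∪ T) (Set.union_subset hSI hTI) (hSfin.union hTfin)
      rw [← ends_union] at h2
      rw [heq] at h2 h4 hS hm
      omega
    have hSsub : S ⊆ T := Set.subset_union_left.trans (hTmax hST Set.subset_union_right)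
    calc G.ends {e} ⊆ G.ends L := G.ends_mono (by simpa using heL)
      _ = G.ends S := heq.symm
      _ ⊆ G.ends T := G.ends_mono hSsub
  have hsub : G.ends ((J \ I) ∪ (J ∩ T)) ⊆ G.ends T := by
    rintro x ⟨f, hf | hf, hx⟩
    · exact hall f hf ⟨f, rfl, hx⟩
    · exact ⟨f, hf.2, hx⟩
  have h1 := hJ ((J \ I) ∪ (J ∩ T)) (Set.union_subset Set.sdiff_subset Set.inter_subset_left)
    (hJfin.subset (Set.union_subset Set.sdiff_subset Set.inter_subset_left))
  have h2 := Set.ncard_le_ncard hsub (G.ends_finite hTfin)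
  have h3 : ((J \ I) ∪ (J ∩ T)).ncard = (J \ I).ncard + (J ∩ T).ncard :=
    Set.ncard_union_eq (Set.disjoint_left.2 fun f hf hf' ↦ hf.2 (hTI hf'.2))
      hJfin.sdiff (hJfin.inter_of_left _)
  have h4 := Set.ncard_inter_add_ncard_sdiff_eq_ncard J I hJfin
  have h5 := Set.ncard_inter_add_ncard_sdiff_eq_ncard I T hIfin
  have h6 : (J ∩ I).ncard ≤ (J ∩ T).ncard + (I \ T).ncard := by
    refine (Set.ncard_le_ncard (t := (J ∩ T) ∪ (I \ T)) ?_
      ((hJfin.inter_of_left _).union hIfin.sdiff)).trans (Set.ncard_union_le _ _)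
    rintro f ⟨hfJ, hfI⟩
    by_cases hfT : f ∈ T
    · exact Or.inl ⟨hfJ, hfT⟩
    · exact Or.inr ⟨hfI, hfT⟩
  rw [Set.inter_eq_self_of_subset_right hTI] at h5
  omega

/-- The bicircular matroid `M_1(G)`, the matroid on `E(G)` with set of circuits `C_1(G)`: a set of
edges is independent if and only if it contains no member of `C_1(G)`. -/
noncomputable def bicircularMatroid {α β : Type*} (G : Graph α β) : Matroid β :=
  (IndepMatroid.ofFinitaryCardAugment
    (E := E(G))
    (Indep := fun I ↦ I ⊆ E(G) ∧ ∀ C ∈ G.circularSets 1, ¬ C ⊆ I)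
    (indep_empty := ⟨Set.empty_subset _,
      (G.forall_circularSets_not_subset_iff (Set.empty_subset _)).2 fun J hJ _ ↦ by
        simp [Set.subset_empty_iff.1 hJ]⟩)
    (indep_subset := fun _ _ hJ hIJ ↦
      ⟨hIJ.trans hJ.1, fun C hC hCI ↦ hJ.2 C hC (hCI.trans hIJ)⟩)
    (indep_aug := by
      rintro I J ⟨hIE, hI⟩ hIfin ⟨hJE, hJ⟩ hJfin hlt
      obtain ⟨e, heJ, heI, he⟩ := G.exists_augment hIfin hJfin
        ((G.forall_circularSets_not_subset_iff hIE).1 hI)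
        ((G.forall_circularSets_not_subset_iff hJE).1 hJ) hlt
      have hE : insert e I ⊆ E(G) := Set.insert_subset (hJE heJ) hIE
      exact ⟨e, heJ, heI, hE, (G.forall_circularSets_not_subset_iff hE).2 he⟩)
    (indep_compact := by
      refine fun I h ↦ ⟨fun e he ↦ ?_, fun C hC hCI ↦ (h C hCI hC.2.1).2 C hC subset_rfl⟩
      exact (h {e} (by simpa using he) (Set.finite_singleton e)).1 rfl)
    (subset_ground := fun _ h ↦ h.1)).matroid

lemma bicircularMatroid_indep_iff {α β : Type*} (G : Graph α β) {I : Set β} :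
    G.bicircularMatroid.Indep I ↔ I ⊆ E(G) ∧ ∀ C ∈ G.circularSets 1, ¬ C ⊆ I := Iff.rfl

@[simp] lemma bicircularMatroid_ground {α β : Type*} (G : Graph α β) :
    G.bicircularMatroid.E = E(G) := rfl

/-- No member of `C_1(G)` properly contains another one. -/
lemma circularSets_antichain {α β : Type*} (G : Graph α β) {C D : Set β}
    (hC : C ∈ G.circularSets 1) (hD : D ∈ G.circularSets 1) (hDC : D ⊆ C) : C ⊆ D := by
  classical
  obtain ⟨hCE, hCfin, hCex, hCc⟩ := hC
  obtain ⟨hDE, hDfin, hDex, -⟩ := hD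
  rw [excess, edgeSet_edgeInduce hCE, vertexSet_edgeInduce] at hCex
  rw [excess, edgeSet_edgeInduce hDE, vertexSet_edgeInduce] at hDex
  by_contra hne
  set H := G.edgeInduce C with hH
  have hcard : (C \ D).ncard = (G.ends C \ G.ends D).ncard := by
    have h1 := Set.ncard_sdiff_add_ncard_of_subset hDC hCfin
    have h2 := Set.ncard_sdiff_add_ncard_of_subset (G.ends_mono hDC) (G.ends_finite hCfin)
    omega
  obtain ⟨U, hU⟩ := ((G.ends_finite hCfin).sdiff (t := G.ends D)).exists_finset_coe
  obtain ⟨K, hK⟩ := (hCfin.sdiff (t := D)).exists_finset_coe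
  rw [← hU, ← hK, Set.ncard_coe_finset, Set.ncard_coe_finset] at hcard
  have hUK : ∀ x ∈ U, ∀ e, H.Inc e x → e ∈ K := by
    intro x hx e he
    rw [← Finset.mem_coe, hU] at hx
    rw [edgeInduce_inc] at he
    rw [← Finset.mem_coe, hK]
    exact ⟨he.1, fun heD ↦ hx.2 ⟨e, heD, he.2⟩⟩
  let w : β → α → ℕ := fun e x ↦
    (if H.Inc e x then 1 else 0) + (if H.IsLoopAt e x then 1 else 0)
  have hdeg : ∀ x ∈ U, H.deg x = (∑ e ∈ K, w e x : ℕ) := by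
    intro x hx
    have ha : H.incidenceSet x = (K.filter fun e ↦ H.Inc e x : Finset β) := by
      ext e
      simpa using hUK x hx e
    have hb : H.loopSet x = (K.filter fun e ↦ H.IsLoopAt e x : Finset β) := by
      ext e
      simpa using fun h : H.IsLoopAt e x ↦ hUK x hx e h.inc
    rw [deg, ha, hb, Set.encard_coe_eq_coe_finsetCard, Set.encard_coe_eq_coe_finsetCard,
      Finset.sum_add_distrib, ← Finset.card_filter, ← Finset.card_filter]
    push_cast
    rfl
  have hdeg2 : ∀ x ∈ U, 2 ≤ ∑ e ∈ K, w e x := by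
    intro x hx
    have hxV : x ∈ V(H) := by
      rw [← Finset.mem_coe, hU] at hx
      exact hx.1
    have h1 := hCc.noLeaf x hxV
    rw [hdeg x hx] at h1
    obtain ⟨e, he⟩ := hCc.noIsolated x hxV
    have h0 : w e x ≤ ∑ e ∈ K, w e x :=
      Finset.single_le_sum (f := fun e ↦ w e x) (fun _ _ ↦ Nat.zero_le _) (hUK x hx e he)
    have h2 : 1 ≤ w e x := by
      have : H.Inc e x := he
      simp [w, this]
    have h3 : ∑ e ∈ K, w e x ≠ 1 := by exact_mod_cast h1
    omega
  have hw : ∀ e ∈ K, ∑ x ∈ U, w e x ≤ 2 ∧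
      ((∃ x y, H.IsLink e x y ∧ x ∈ U ∧ y ∉ U) → ∑ x ∈ U, w e x ≤ 1) := by
    intro e he
    have aux : ∀ x y, H.IsLink e x y → ∑ z ∈ U, w e z ≤ 2 ∧ (y ∉ U → ∑ z ∈ U, w e z ≤ 1) := by
      intro x y hxy
      have hInc : (U.filter fun z ↦ H.Inc e z) ⊆ U.filter fun z ↦ z = x ∨ z = y := by
        intro z hz
        rw [Finset.mem_filter] at hz ⊢
        exact ⟨hz.1, hz.2.eq_or_eq_of_isLink hxy⟩
      have hsum : ∑ z ∈ U, w e z =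
          (U.filter fun z ↦ H.Inc e z).card + (U.filter fun z ↦ H.IsLoopAt e z).card := by
        rw [Finset.sum_add_distrib, ← Finset.card_filter, ← Finset.card_filter]
      by_cases hxy' : x = y
      · subst hxy'
        have hi : ∀ z ∈ U.filter fun z ↦ H.Inc e z, z = x ∧ z ∈ U := fun z hz ↦ by
          have := Finset.mem_filter.1 (hInc hz)
          grind
        have hl : (U.filter fun z ↦ H.IsLoopAt e z) ⊆ U.filter fun z ↦ H.Inc e z :=
          Finset.monotone_filter_right _ fun z _ hz ↦ hz.inc
        have c1 : (U.filter fun z ↦ H.Inc e z).card ≤ 1 :=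
          Finset.card_le_one.2 fun a ha b hb ↦ (hi a ha).1.trans (hi b hb).1.symm
        have c2 := Finset.card_le_card hl
        refine ⟨by omega, fun hx ↦ ?_⟩
        have c3 : (U.filter fun z ↦ H.Inc e z) = ∅ :=
          Finset.eq_empty_of_forall_notMem fun z hz ↦ hx ((hi z hz).1 ▸ (hi z hz).2)
        rw [c3, Finset.card_empty] at c2 hsum
        omega
      · have hl : (U.filter fun z ↦ H.IsLoopAt e z) = ∅ := by
          refine Finset.filter_eq_empty_iff.2 fun z _ hz ↦ hxy' ?_
          have h1 := hxy.inc_left.eq_or_eq_of_isLink hz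
          have h2 := hxy.inc_right.eq_or_eq_of_isLink hz
          grind
        rw [hl, Finset.card_empty, add_zero] at hsum
        constructor
        · rw [hsum]
          refine (Finset.card_le_card (t := {x, y}) fun z hz ↦ ?_).trans Finset.card_le_two
          have := (Finset.mem_filter.1 (hInc hz)).2
          simpa using this
        · intro hy
          rw [hsum]
          refine (Finset.card_le_card (t := {x}) fun z hz ↦ ?_).trans (by simp)
          have := Finset.mem_filter.1 (hInc hz)
          grind
    have heE : e ∈ E(H) := by
      rw [edgeSet_edgeInduce hCE]
      rw [← Finset.mem_coe, hK] at he
      exact he.1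
    obtain ⟨x, y, hxy⟩ := H.exists_isLink_of_mem_edgeSet heE
    exact ⟨(aux x y hxy).1, fun ⟨a, b, hab, _, hb⟩ ↦ (aux a b hab).2 hb⟩
  have hsumU : ∑ x ∈ U, ∑ e ∈ K, w e x = ∑ x ∈ U, 2 := by
    refine le_antisymm ?_ (Finset.sum_le_sum hdeg2)
    rw [Finset.sum_comm]
    refine (Finset.sum_le_sum fun e he ↦ (hw e he).1).trans ?_
    simp [hcard]
  have hsumK : ∑ e ∈ K, ∑ x ∈ U, w e x = ∑ e ∈ K, 2 := by
    rw [Finset.sum_comm, hsumU]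
    simp [hcard]
  have htwo := (Finset.sum_eq_sum_iff_of_le hdeg2).1 hsumU.symm
  have hboth := (Finset.sum_eq_sum_iff_of_le fun e he ↦ (hw e he).1).1 hsumK
  have hclosed : ∀ x y, H.Adj x y → x ∈ U → y ∈ U := by
    rintro x y ⟨e, hxy⟩ hx
    by_contra hy
    have heK := hUK x hx e hxy.inc_left
    have := (hw e heK).2 ⟨x, y, hxy, hx, hy⟩
    have := hboth e heK
    omega
  have hUne : U.Nonempty := by
    obtain ⟨e, heC, heD⟩ := Set.not_subset.1 hne
    have : e ∈ K := by
      rw [← Finset.mem_coe, hK]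
      exact ⟨heC, heD⟩
    exact Finset.card_pos.1 (hcard ▸ Finset.card_pos.2 ⟨e, this⟩)
  obtain ⟨x, hx⟩ := hUne
  have hxV : x ∈ V(H) := by
    rw [← Finset.mem_coe, hU] at hx
    exact hx.1
  refine hCc.noCycleComponent (H.toSimpleGraph.connectedComponentMk ⟨x, hxV⟩) fun y hy ↦ ?_
  have hreach : H.toSimpleGraph.Reachable ⟨x, hxV⟩ y :=
    (SimpleGraph.ConnectedComponent.exact hy).symm
  have hyU : (y : α) ∈ U := by
    obtain ⟨p⟩ := hreach
    have key : ∀ (a b : V(H)), H.toSimpleGraph.Walk a b → (a : α) ∈ U → (b : α) ∈ U := by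
      intro a b p
      induction p with
      | nil => exact id
      | cons h _ ih => exact fun ha ↦ ih (hclosed _ _ h.2 ha)
    exact key _ _ p hx
  rw [hdeg y hyU, ← htwo y hyU]
  rfl

/-- The circuits of `M_1(G)` are exactly the members of `C_1(G)`. -/
theorem bicircularMatroid_isCircuit_iff {α β : Type*} (G : Graph α β) {C : Set β} :
    G.bicircularMatroid.IsCircuit C ↔ C ∈ G.circularSets 1 := by
  have hdep : ∀ D ∈ G.circularSets 1, G.bicircularMatroid.Dep D := fun D hD ↦
    ⟨fun h ↦ (G.bicircularMatroid_indep_iff.1 h).2 D hD subset_rfl, hD.1⟩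
  have hone : ∀ D, G.bicircularMatroid.IsCircuit D → D ∈ G.circularSets 1 := by
    intro D hD
    have hnot : ¬ (D ⊆ E(G) ∧ ∀ F ∈ G.circularSets 1, ¬ F ⊆ D) := hD.not_indep
    push Not at hnot
    obtain ⟨F, hF, hFD⟩ := hnot hD.subset_ground
    rwa [← hD.eq_of_dep_subset (hdep F hF) hFD]
  refine ⟨hone C, fun hC ↦ ?_⟩
  obtain ⟨D, hDC, hD⟩ := (hdep C hC).exists_isCircuit_subset
  rwa [(G.circularSets_antichain hC (hone D hD) hDC).antisymm hDC]

/-- `G` is `n`-connected: it has more than `n` vertices and remains connected after the deletion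
of fewer than `n` vertices. -/
def IsVertexConnected {α β : Type*} (G : Graph α β) (n : ℕ) : Prop :=
  (n : ℕ∞) < V(G).encard ∧
    ∀ X ⊆ V(G), X.encard < n → (G.deleteVerts X).toSimpleGraph.Connected

/-- Isomorphism of multigraphs. -/
def Isomorphic {α β α' β' : Type*} (G : Graph α β) (G' : Graph α' β') : Prop :=
  ∃ (ν : V(G) ≃ V(G')) (ε : E(G) ≃ E(G')), ∀ (e : E(G)) (x y : V(G)),
    G.IsLink e x y ↔ G'.IsLink (ε e) (ν x) (ν y)

/-- Strong isomorphism of multigraphs with the same edge set: a bijection of the vertex sets that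
respects the ends of every edge. -/
def StronglyIsomorphic {α α' β : Type*} (G : Graph α β) (G' : Graph α' β) : Prop :=
  E(G) = E(G') ∧ ∃ ν : V(G) ≃ V(G'), ∀ (e : β) (x y : V(G)),
    G.IsLink e x y ↔ G'.IsLink e (ν x) (ν y)

end Graph

/-!
The rank of an edge set `X` in the bicircular matroid is the minimum of `|ends Y| + |X \ Y|` over
`Y ⊆ X`, so `M₁(G)` knows the number of ends of every edge set in which it has no coloop. Write
`δ(v)` for the set of edges at a vertex `v`. If every other vertex keeps at least two edges in
`E \ δ(v)`, a degree count shows that this set has rank `|V| - 1`; by 2-connectedness it has no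
coloop when it has at least `|V|` edges. In that case `E \ δ(v)` has `|V| - 1` ends in `G'` as well,
so it misses a vertex `v'` of `G'`, and `δ(v') ⊆ δ(v)` is an equality because adding any edge of
`δ(v)` raises the rank. As there are at least five vertices, all of degree at least three, at most
one vertex `v` has fewer than `|V|` edges in `E \ δ(v)`; then all these edges have two ends other
than `v`, so the stars already recovered show that none of them meets the remaining vertex of `G'`.
-/

namespace BicircularMatroid

open Graph Set

variable {α α' β : Type*} {G : Graph α β} {G' : Graph α' β} {n : ℕ} {e : β} {x y v : α}
  {v' : α'} {C I T X F : Set β} {S U W : Set α}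

lemma ends_subset_vertexSet : G.ends X ⊆ V(G) := fun _ ⟨_, _, hx⟩ ↦ hx.vertex_mem

lemma ends_edgeSet (hG : G.NoIsolated) : G.ends E(G) = V(G) :=
  ends_subset_vertexSet.antisymm fun x hx ↦
    have ⟨e, he⟩ := hG x hx
    ⟨e, he.edge_mem, he⟩

lemma ends_sdiff_incidenceSet_subset :
    G.ends (X \ G.incidenceSet v) ⊆ V(G) \ {v} := by
  rintro x ⟨e, he, hex⟩
  refine ⟨hex.vertex_mem, ?_⟩
  rintro rfl
  exact he.2 hex

lemma edgeSet_sdiff_incidenceSet_inter :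
    (E(G) \ G.incidenceSet v) ∩ G.incidenceSet x = G.incidenceSet x \ G.incidenceSet v := by
  rw [← inter_sdiff_right_comm,
    inter_eq_self_of_subset_right (G.incidenceSet_subset_edgeSet x)]

/-! ### The rank of an edge set -/

lemma finite_of_isCircuit (hC : G.bicircularMatroid.IsCircuit C) : C.Finite :=
  (G.bicircularMatroid_isCircuit_iff.1 hC).2.1

lemma ncard_ends_add_one_of_isCircuit (hC : G.bicircularMatroid.IsCircuit C) :
    (G.ends C).ncard + 1 = C.ncard := by
  obtain ⟨hCE, -, hexcess, -⟩ := G.bicircularMatroid_isCircuit_iff.1 hC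
  rw [excess, edgeSet_edgeInduce hCE, vertexSet_edgeInduce] at hexcess
  omega

lemma ncard_le_ncard_ends_of_indep (hI : G.bicircularMatroid.Indep I) (hfin : I.Finite) :
    I.ncard ≤ (G.ends I).ncard :=
  have ⟨hIE, hcircuit⟩ := G.bicircularMatroid_indep_iff.1 hI
  (G.forall_circularSets_not_subset_iff hIE).1 hcircuit I subset_rfl hfin

lemma ends_sdiff_singleton_of_isCircuit (hC : G.bicircularMatroid.IsCircuit C) (he : e ∈ C) :
    G.ends (C \ {e}) = G.ends C := by
  have hfin := finite_of_isCircuit hC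
  have hindep := ncard_le_ncard_ends_of_indep (hC.sdiff_singleton_indep he) hfin.sdiff
  have hcircuit := ncard_ends_add_one_of_isCircuit hC
  have hcard := ncard_sdiff_singleton_add_one he hfin
  exact eq_of_subset_of_ncard_le (G.ends_mono sdiff_subset) (by omega) (G.ends_finite hfin)

/-- An edge set is tight if it has exactly as many edges as ends; among independent sets this is
the extremal case of `ncard_le_ncard_ends_of_indep`. -/
def IsTight (G : Graph α β) (T : Set β) : Prop :=
  (G.ends T).ncard = T.ncard

lemma isTight_empty : IsTight G ∅ := by simp [IsTight, ends]

lemma isTight_sdiff_singleton_of_isCircuit (hC : G.bicircularMatroid.IsCircuit C) (he : e ∈ C) :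
    IsTight G (C \ {e}) := by
  have hcard := ncard_sdiff_singleton_add_one he (finite_of_isCircuit hC)
  have hcircuit := ncard_ends_add_one_of_isCircuit hC
  rw [IsTight, ends_sdiff_singleton_of_isCircuit hC he]
  omega

lemma isTight_union {S : Set β} (hI : G.bicircularMatroid.Indep (S ∪ T)) (hS : S.Finite)
    (hT : T.Finite) (hSt : IsTight G S) (hTt : IsTight G T) : IsTight G (S ∪ T) := by
  have hunion := ncard_le_ncard_ends_of_indep hI (hS.union hT)
  have hinter := ncard_le_ncard_ends_of_indep
    (hI.subset (inter_subset_left.trans subset_union_left)) (hS.inter_of_left T)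
  have hsubmod : (G.ends (S ∩ T)).ncard ≤ (G.ends S ∩ G.ends T).ncard :=
    ncard_le_ncard
      (subset_inter (G.ends_mono inter_subset_left) (G.ends_mono inter_subset_right))
      ((G.ends_finite hS).inter_of_left _)
  have hedges := ncard_union_add_ncard_inter S T hS hT
  have hends := ncard_union_add_ncard_inter (G.ends S) (G.ends T) (G.ends_finite hS)
    (G.ends_finite hT)
  rw [← ends_union] at hends
  rw [IsTight] at hSt hTt ⊢
  omega

lemma exists_isTight_forall_subset (hI : G.bicircularMatroid.Indep I) (hfin : I.Finite) :
    ∃ T ⊆ I, IsTight G T ∧ ∀ S ⊆ I, IsTight G S → S ⊆ T := by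
  obtain ⟨T, -, ⟨hTI, hT⟩, hmax⟩ :=
    (hfin.finite_subsets.subset (t := {T | T ⊆ I ∧ IsTight G T}) fun _ h ↦ h.1).exists_le_maximal
      ⟨empty_subset I, isTight_empty⟩
  refine ⟨T, hTI, hT, fun S hSI hS ↦ ?_⟩
  have hST : IsTight G (S ∪ T) := isTight_union (hI.subset (union_subset hSI hTI))
    (hfin.subset hSI) (hfin.subset hTI) hS hT
  exact subset_union_left.trans (hmax ⟨union_subset hSI hTI, hST⟩ subset_union_right)

lemma eRk_le_encard_ends (hX : X.Finite) :
    G.bicircularMatroid.eRk X ≤ (G.ends X).encard := by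
  refine Matroid.eRk_le_iff.2 fun I hIX hI ↦ ?_
  have hIfin := hX.subset hIX
  calc I.encard = I.ncard := hIfin.cast_ncard_eq.symm
    _ ≤ (G.ends I).ncard := mod_cast ncard_le_ncard_ends_of_indep hI hIfin
    _ = (G.ends I).encard := (G.ends_finite hIfin).cast_ncard_eq
    _ ≤ (G.ends X).encard := encard_le_encard (G.ends_mono hIX)

lemma eRk_le_encard_ends_add_encard_sdiff {Y : Set β} (hY : Y.Finite) (X : Set β) :
    G.bicircularMatroid.eRk X ≤ (G.ends Y).encard + (X \ Y).encard :=
  calc G.bicircularMatroid.eRk X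
      ≤ G.bicircularMatroid.eRk (Y ∪ X \ Y) :=
        Matroid.eRk_mono _ (by rw [union_sdiff_self]; exact subset_union_right)
    _ ≤ G.bicircularMatroid.eRk Y + (X \ Y).encard := Matroid.eRk_union_le_eRk_add_encard _ _ _
    _ ≤ (G.ends Y).encard + (X \ Y).encard := by
        gcongr
        exact eRk_le_encard_ends hY

lemma exists_encard_ends_add_encard_sdiff_le_eRk (hX : X.Finite) (hXE : X ⊆ E(G)) :
    ∃ Y ⊆ X, (G.ends Y).encard + (X \ Y).encard ≤ G.bicircularMatroid.eRk X := by
  obtain ⟨I, hI⟩ := G.bicircularMatroid.exists_isBasis X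
  have hIfin := hX.subset hI.subset
  obtain ⟨T, hTI, hT, hmax⟩ := exists_isTight_forall_subset hI.indep hIfin
  have hends : G.ends (T ∪ X \ I) ⊆ G.ends T := by
    rintro v ⟨e, heT | ⟨heX, heI⟩, hev⟩
    · exact ⟨e, heT, hev⟩
    have hcircuit := hI.indep.fundCircuit_isCircuit (hI.subset_closure heX) heI
    have he := G.bicircularMatroid.mem_fundCircuit e I
    have hsub : G.bicircularMatroid.fundCircuit e I \ {e} ⊆ T :=
      hmax _ (sdiff_singleton_subset_iff.2 (G.bicircularMatroid.fundCircuit_subset_insert e I))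
        (isTight_sdiff_singleton_of_isCircuit hcircuit he)
    refine G.ends_mono hsub ?_
    rw [ends_sdiff_singleton_of_isCircuit hcircuit he]
    exact ⟨e, he, hev⟩
  refine ⟨T ∪ X \ I, union_subset (hTI.trans hI.subset) sdiff_subset, ?_⟩
  have hsdiff : X \ (T ∪ X \ I) ⊆ I \ T := by
    intro e he
    grind
  have hTt : (G.ends T).encard = T.encard := by
    rw [← (hIfin.subset hTI).cast_ncard_eq, ← hT,
      (G.ends_finite (hIfin.subset hTI)).cast_ncard_eq]
  calc (G.ends (T ∪ X \ I)).encard + (X \ (T ∪ X \ I)).encard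
      ≤ T.encard + (I \ T).encard :=
        add_le_add ((encard_le_encard hends).trans_eq hTt) (encard_le_encard hsdiff)
    _ = I.encard := by rw [add_comm, encard_sdiff_add_encard_of_subset hTI]
    _ = G.bicircularMatroid.eRk X := hI.encard_eq_eRk

lemma eRk_eq_encard_ends_of_forall_le (hX : X.Finite) (hXE : X ⊆ E(G))
    (hcoloop : ∀ e ∈ X, G.bicircularMatroid.eRk X ≤ G.bicircularMatroid.eRk (X \ {e})) :
    G.bicircularMatroid.eRk X = (G.ends X).encard := by
  obtain ⟨Y, hYX, hY⟩ := exists_encard_ends_add_encard_sdiff_le_eRk hX hXE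
  suffices X ⊆ Y by
    rw [hYX.antisymm this, sdiff_self, encard_empty, add_zero] at hY
    exact (eRk_le_encard_ends hX).antisymm hY
  intro e heX
  by_contra heY
  have hYfin := hX.subset hYX
  have hlt : (G.ends Y).encard + ((X \ {e}) \ Y).encard < (G.ends Y).encard + (X \ Y).encard := by
    refine (ENat.add_lt_add_iff_left (G.ends_finite hYfin).encard_lt_top.ne).2 ?_
    exact hX.sdiff.sdiff.encard_lt_encard
      ((sdiff_subset_sdiff_left sdiff_subset).ssubset_of_mem_notMem ⟨heX, heY⟩ (by simp))
  exact ((hY.trans (hcoloop e heX)).trans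
    (eRk_le_encard_ends_add_encard_sdiff hYfin (X \ {e}))).not_gt hlt

lemma eRk_insert_of_notMem_ends (hev : G.Inc e v) (hv : v ∉ G.ends X) :
    G.bicircularMatroid.eRk (insert e X) = G.bicircularMatroid.eRk X + 1 := by
  refine Matroid.eRk_insert_eq_add_one ⟨hev.edge_mem, fun hcl ↦ ?_⟩
  have heX : e ∉ X := fun heX ↦ hv ⟨e, heX, hev⟩
  obtain ⟨C, hCX, hC, heC⟩ := Matroid.exists_isCircuit_of_mem_closure hcl heX
  have hvC : v ∈ G.ends (C \ {e}) := by
    rw [ends_sdiff_singleton_of_isCircuit hC heC]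
    exact ⟨e, heC, hev⟩
  exact hv (G.ends_mono (sdiff_singleton_subset_iff.2 hCX) hvC)

/-! ### Counting incidences -/

/-- The edges of `F` with at least one end in `S`: the neighbourhood of `S` in the Hall-type
criterion for `F` to have rank at least `|U|`, where `S` ranges over the subsets of `U`. -/
def edgesMeeting (G : Graph α β) (F : Set β) (S : Set α) : Set β :=
  {e ∈ F | ∃ x ∈ S, G.Inc e x}

lemma edgesMeeting_subset : edgesMeeting G F S ⊆ F := fun _ he ↦ he.1

lemma edgesMeeting_sdiff_singleton : edgesMeeting G (F \ {e}) S = edgesMeeting G F S \ {e} := by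
  ext f
  simp only [edgesMeeting, mem_ofPred_eq, mem_sdiff, mem_singleton_iff]
  tauto

lemma encard_le_eRk_of_forall_ncard_le (hX : X.Finite) (hXE : X ⊆ E(G)) (hU : U.Finite)
    (hHall : ∀ S ⊆ U, S.ncard ≤ (edgesMeeting G X S).ncard) :
    U.encard ≤ G.bicircularMatroid.eRk X := by
  obtain ⟨Y, -, hY⟩ := exists_encard_ends_add_encard_sdiff_le_eRk hX hXE
  have hsub : edgesMeeting G X (U \ G.ends Y) ⊆ X \ Y :=
    fun e ⟨heX, x, ⟨_, hxY⟩, hex⟩ ↦ ⟨heX, fun heY ↦ hxY ⟨e, heY, hex⟩⟩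
  have hcard := (hHall (U \ G.ends Y) sdiff_subset).trans (ncard_le_ncard hsub hX.sdiff)
  calc U.encard ≤ (U \ G.ends Y).encard + (G.ends Y).encard :=
        encard_le_encard_sdiff_add_encard _ _
    _ ≤ (X \ Y).encard + (G.ends Y).encard := by
        rw [← hU.sdiff.cast_ncard_eq, ← hX.sdiff.cast_ncard_eq]
        gcongr
    _ = (G.ends Y).encard + (X \ Y).encard := add_comm _ _
    _ ≤ G.bicircularMatroid.eRk X := hY

/-- The edges of `F` with a single end in `S`: the edges leaving `S` and the loops in `S`.
They are the correction term when incidences with `S` are double counted. -/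
def edgesMeetingOnce (G : Graph α β) (F : Set β) (S : Set α) : Set β :=
  {e ∈ F | ∃! x, x ∈ S ∧ G.Inc e x}

lemma mem_edgesMeetingOnce_of_isLink (he : e ∈ F) (hxy : G.IsLink e x y) (hx : x ∈ S)
    (hy : y ∉ S) : e ∈ edgesMeetingOnce G F S := by
  refine ⟨he, x, ⟨hx, hxy.inc_left⟩, fun z ⟨hz, hez⟩ ↦ ?_⟩
  obtain rfl | rfl := hez.eq_or_eq_of_isLink hxy
  · rfl
  · exact absurd hz hy

open Classical in
lemma card_filter_inc_add_ite (S : Finset α) (e : β) :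
    (S.filter (G.Inc e ·)).card + (if ∃! x, x ∈ S ∧ G.Inc e x then 1 else 0) =
      if ∃ x ∈ S, G.Inc e x then 2 else 0 := by
  have htwo : (S.filter (G.Inc e ·)).card ≤ 2 := by
    by_cases he : e ∈ E(G)
    · obtain ⟨x, y, hxy⟩ := G.exists_isLink_of_mem_edgeSet he
      refine (Finset.card_le_card (t := {x, y}) fun z hz ↦ ?_).trans Finset.card_le_two
      simpa using (Finset.mem_filter.1 hz).2.eq_or_eq_of_isLink hxy
    · simp [he]
  have hone : (S.filter (G.Inc e ·)).card = 1 ↔ ∃! x, x ∈ S ∧ G.Inc e x := by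
    simp [Finset.card_eq_one_iff_existsUnique]
  have hpos : 0 < (S.filter (G.Inc e ·)).card ↔ ∃ x ∈ S, G.Inc e x := by
    simp [Finset.card_pos, Finset.filter_nonempty_iff]
  simp only [← hone, ← hpos]
  split_ifs <;> omega

lemma sum_ncard_inter_incidenceSet_add (hF : F.Finite) (S : Finset α) :
    ∑ x ∈ S, (F ∩ G.incidenceSet x).ncard + (edgesMeetingOnce G F S).ncard =
      2 * (edgesMeeting G F S).ncard := by
  classical
  lift F to Finset β using hF
  have hdeg (x : α) : ((F : Set β) ∩ G.incidenceSet x).ncard = (F.filter (G.Inc · x)).card := by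
    rw [← ncard_coe_finset]
    congr 1
    ext
    simp
  have honce : (edgesMeetingOnce G F S).ncard =
      (F.filter fun e ↦ ∃! x, x ∈ S ∧ G.Inc e x).card := by
    rw [← ncard_coe_finset, Finset.coe_filter]
    rfl
  have hmeeting : (edgesMeeting G F S).ncard = (F.filter fun e ↦ ∃ x ∈ S, G.Inc e x).card := by
    rw [← ncard_coe_finset, Finset.coe_filter]
    rfl
  have hcomm : ∑ x ∈ S, (F.filter (G.Inc · x)).card = ∑ e ∈ F, (S.filter (G.Inc e ·)).card :=
    Finset.sum_card_bipartiteAbove_eq_sum_card_bipartiteBelow fun x e ↦ G.Inc e x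
  simp only [hdeg]
  rw [hcomm, honce, hmeeting, Finset.card_filter, Finset.card_filter, Finset.mul_sum,
    ← Finset.sum_add_distrib]
  refine Finset.sum_congr rfl fun e _ ↦ ?_
  rw [card_filter_inc_add_ite]
  split_ifs <;> rfl

lemma two_mul_ncard_add_ncard_edgesMeetingOnce_le (hF : F.Finite) (hS : S.Finite)
    (hdeg : ∀ x ∈ S, 2 ≤ (F ∩ G.incidenceSet x).ncard) :
    2 * S.ncard + (edgesMeetingOnce G F S).ncard ≤ 2 * (edgesMeeting G F S).ncard := by
  lift S to Finset α using hS
  rw [← sum_ncard_inter_incidenceSet_add hF, ncard_coe_finset, mul_comm, ← smul_eq_mul]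
  gcongr
  exact Finset.card_nsmul_le_sum _ _ _ hdeg

lemma two_mul_ncard_add_le_two_mul_ncard_sdiff_incidenceSet (hE : E(G).Finite) (hV : V(G).Finite)
    (hdeg : ∀ x ∈ V(G) \ {v}, 2 ≤ (G.incidenceSet x \ G.incidenceSet v).ncard) :
    2 * (V(G) \ {v}).ncard + (edgesMeetingOnce G (E(G) \ G.incidenceSet v) (V(G) \ {v})).ncard ≤
      2 * (E(G) \ G.incidenceSet v).ncard :=
  (two_mul_ncard_add_ncard_edgesMeetingOnce_le hE.sdiff hV.sdiff fun x hx ↦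
    edgeSet_sdiff_incidenceSet_inter (G := G) ▸ hdeg x hx).trans
    (Nat.mul_le_mul_left 2 (ncard_le_ncard edgesMeeting_subset hE.sdiff))

lemma encard_le_eRk_of_forall_two_le (hX : X.Finite) (hXE : X ⊆ E(G)) (hU : U.Finite)
    (hdeg : ∀ x ∈ U, 2 ≤ (X ∩ G.incidenceSet x).ncard) :
    U.encard ≤ G.bicircularMatroid.eRk X := by
  refine encard_le_eRk_of_forall_ncard_le hX hXE hU fun S hS ↦ ?_
  have := two_mul_ncard_add_ncard_edgesMeetingOnce_le hX (hU.subset hS) fun x hx ↦ hdeg x (hS hx)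
  omega

lemma encard_le_eRk_edgeSet_sdiff_singleton (hE : E(G).Finite) (hV : V(G).Finite)
    (hdeg : ∀ x ∈ V(G), 3 ≤ (G.incidenceSet x).ncard) (e : β) :
    V(G).encard ≤ G.bicircularMatroid.eRk (E(G) \ {e}) := by
  refine encard_le_eRk_of_forall_two_le hE.sdiff sdiff_subset hV fun x hx ↦ ?_
  have hsub : G.incidenceSet x \ {e} ⊆ (E(G) \ {e}) ∩ G.incidenceSet x :=
    fun f hf ↦ ⟨⟨G.incidenceSet_subset_edgeSet x hf.1, hf.2⟩, hf.1⟩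
  have hle := ncard_le_ncard hsub (hE.sdiff.inter_of_left _)
  have hpred := pred_ncard_le_ncard_sdiff_singleton (G.incidenceSet x) e
  have h3 := hdeg x hx
  omega

lemma encard_le_eRk_sdiff_incidenceSet (hE : E(G).Finite) (hV : V(G).Finite)
    (hdeg : ∀ x ∈ V(G) \ {v}, 2 ≤ (G.incidenceSet x \ G.incidenceSet v).ncard) :
    (V(G) \ {v}).encard ≤ G.bicircularMatroid.eRk (E(G) \ G.incidenceSet v) :=
  encard_le_eRk_of_forall_two_le hE.sdiff sdiff_subset hV.sdiff fun x hx ↦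
    edgeSet_sdiff_incidenceSet_inter (G := G) ▸ hdeg x hx

lemma ncard_le_ncard_sdiff_incidenceSet_or (hE : E(G).Finite) (hcard : 5 ≤ V(G).ncard)
    (hdeg : ∀ x ∈ V(G), 3 ≤ (G.incidenceSet x).ncard) (hu : u ∈ V(G)) (hv : v ∈ V(G))
    (huv : u ≠ v) :
    V(G).ncard ≤ (E(G) \ G.incidenceSet u).ncard ∨
      V(G).ncard ≤ (E(G) \ G.incidenceSet v).ncard := by
  classical
  have hV : V(G).Finite := finite_of_ncard_pos (by omega)
  obtain ⟨V, hVG⟩ := hV.exists_finset_coe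
  have hsum : ∑ x ∈ V, (G.incidenceSet x).ncard ≤ 2 * E(G).ncard := by
    have h := sum_ncard_inter_incidenceSet_add (G := G) hE V
    simp only [fun x ↦ inter_eq_self_of_subset_right (G.incidenceSet_subset_edgeSet x)] at h
    have hle := ncard_le_ncard (edgesMeeting_subset (G := G) (S := V)) hE
    omega
  have huV : u ∈ V := by rwa [← Finset.mem_coe, hVG]
  have hvV : v ∈ V.erase u := Finset.mem_erase.2 ⟨huv.symm, by rwa [← Finset.mem_coe, hVG]⟩
  have hrest : ((V.erase u).erase v).card * 3 ≤
      ∑ x ∈ (V.erase u).erase v, (G.incidenceSet x).ncard :=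
    Finset.card_nsmul_le_sum _ _ _ fun x hx ↦ hdeg x
      (hVG ▸ Finset.mem_of_mem_erase (Finset.mem_of_mem_erase hx))
  rw [← Finset.add_sum_erase V _ huV, ← Finset.add_sum_erase _ _ hvV] at hsum
  have hEu := ncard_sdiff_add_ncard_of_subset (G.incidenceSet_subset_edgeSet u) hE
  have hEv := ncard_sdiff_add_ncard_of_subset (G.incidenceSet_subset_edgeSet v) hE
  have hVcard : V(G).ncard = V.card := by rw [← hVG, ncard_coe_finset]
  rw [Finset.card_erase_of_mem hvV, Finset.card_erase_of_mem huV] at hrest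
  omega

lemma exists_inc_ne_of_ncard_lt (hE : E(G).Finite) (hV : V(G).Finite) (hv : v ∈ V(G))
    (hdeg : ∀ x ∈ V(G) \ {v}, 2 ≤ (G.incidenceSet x \ G.incidenceSet v).ncard)
    (hcard : (E(G) \ G.incidenceSet v).ncard < V(G).ncard)
    (he : e ∈ E(G) \ G.incidenceSet v) :
    ∃ x ∈ V(G) \ {v}, ∃ y ∈ V(G) \ {v}, x ≠ y ∧ G.Inc e x ∧ G.Inc e y := by
  have hdouble := two_mul_ncard_add_le_two_mul_ncard_sdiff_incidenceSet hE hV hdeg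
  have hpred := ncard_sdiff_singleton_add_one hv hV
  have honce : edgesMeetingOnce G (E(G) \ G.incidenceSet v) (V(G) \ {v}) = ∅ :=
    (ncard_eq_zero (hE.sdiff.subset fun _ h ↦ h.1)).1 (by omega)
  have hne {z : α} (hz : G.Inc e z) : z ∈ V(G) \ {v} :=
    ends_sdiff_incidenceSet_subset ⟨e, he, hz⟩
  obtain ⟨x, _, hxy⟩ := G.exists_isLink_of_mem_edgeSet he.1
  have hx := hxy.inc_left
  by_contra! hcon
  exact honce.subset ⟨he, x, ⟨hne hx, hx⟩, fun y hy ↦ by_contra fun hyx ↦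
    hcon y hy.1 x (hne hx) hyx hy.2 hx⟩

/-! ### Vertex connectivity -/

lemma isVertexConnected_mono {m : ℕ} (hmn : m ≤ n) (hG : G.IsVertexConnected n) :
    G.IsVertexConnected m :=
  have hle : (m : ℕ∞) ≤ n := mod_cast hmn
  ⟨hle.trans_lt hG.1, fun X hX hXm ↦ hG.2 X hX (hXm.trans_le hle)⟩

lemma exists_isLink_of_ssubset (hG : G.IsVertexConnected n) (hWV : W ⊆ V(G)) (hWn : W.encard < n)
    (hS : S ⊂ V(G) \ W) (hne : S.Nonempty) :
    ∃ e, ∃ x ∈ S, ∃ y ∈ V(G) \ (S ∪ W), G.IsLink e x y := by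
  obtain ⟨x, hx⟩ := hne
  obtain ⟨z, hz, hzS⟩ := exists_of_ssubset hS
  obtain ⟨p⟩ := (hG.2 W hWV hWn).preconnected ⟨x, by simpa using hS.1 hx⟩ ⟨z, by simpa using hz⟩
  obtain ⟨d, -, hd, hd'⟩ := p.exists_boundary_dart {w | (w : α) ∈ S} hx hzS
  obtain ⟨-, e, he⟩ := d.adj
  obtain ⟨hlink, -, hW⟩ := (G.deleteVerts_isLink W).1 he
  exact ⟨e, d.fst, hd, d.snd, ⟨hlink.right_mem, not_or.2 ⟨hd', hW⟩⟩, hlink⟩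

lemma three_le_ncard_incidenceSet (hE : E(G).Finite) (hG : G.IsVertexConnected 1)
    (hdeg : ∀ v ∈ V(G), x ≠ v → 2 ≤ (G.incidenceSet x \ G.incidenceSet v).ncard)
    (hx : x ∈ V(G)) : 3 ≤ (G.incidenceSet x).ncard := by
  have hss : {x} ⊂ V(G) \ ∅ := by
    rw [sdiff_empty]
    refine (singleton_subset_iff.2 hx).ssubset_of_ne fun hxV ↦ ?_
    simpa [← hxV] using hG.1
  obtain ⟨e, _, hz, y, ⟨hy, hyx⟩, he⟩ :=
    exists_isLink_of_ssubset hG (empty_subset _) (by simp) hss (singleton_nonempty x)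
  obtain rfl := mem_singleton_iff.1 hz
  have hlt : (G.incidenceSet _ \ G.incidenceSet y).ncard < (G.incidenceSet _).ncard :=
    ncard_lt_ncard (sdiff_subset.ssubset_of_mem_notMem he.inc_left fun h ↦ h.2 he.inc_right)
      (hE.subset (G.incidenceSet_subset_edgeSet _))
  exact (hdeg y hy fun hxy ↦ hyx (Or.inl hxy.symm)).trans_lt hlt

/- Deleting `e` can cost a vertex set `S` one edge in Hall's condition. An edge leaving `S` makes up
for it; for `S = V(G) \ {v}` there is none, and `hcard` provides the spare edge. -/
lemma encard_le_eRk_sdiff_incidenceSet_sdiff_singleton (hE : E(G).Finite)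
    (hG : G.IsVertexConnected 2) (hV : V(G).Finite) (hv : v ∈ V(G))
    (hdeg : ∀ x ∈ V(G) \ {v}, 2 ≤ (G.incidenceSet x \ G.incidenceSet v).ncard)
    (hcard : V(G).ncard ≤ (E(G) \ G.incidenceSet v).ncard) (e : β) :
    (V(G) \ {v}).encard ≤ G.bicircularMatroid.eRk ((E(G) \ G.incidenceSet v) \ {e}) := by
  set F := E(G) \ G.incidenceSet v
  refine encard_le_eRk_of_forall_ncard_le hE.sdiff.sdiff (sdiff_subset.trans sdiff_subset)
    hV.sdiff fun S hS ↦ ?_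
  suffices hlt : S.Nonempty → S.ncard < (edgesMeeting G F S).ncard by
    obtain rfl | hne := S.eq_empty_or_nonempty
    · simp
    rw [edgesMeeting_sdiff_singleton]
    have := pred_ncard_le_ncard_sdiff_singleton (edgesMeeting G F S) e
    have := hlt hne
    omega
  intro hne
  obtain rfl | hss := hS.eq_or_ssubset
  · have hall : edgesMeeting G F (V(G) \ {v}) = F := edgesMeeting_subset.antisymm fun f hf ↦ by
      obtain ⟨x, y, hxy⟩ := G.exists_isLink_of_mem_edgeSet hf.1
      refine ⟨hf, x, ⟨hxy.left_mem, ?_⟩, hxy.inc_left⟩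
      rintro rfl
      exact hf.2 hxy.inc_left
    rw [hall]
    exact (ncard_sdiff_singleton_lt_of_mem hv hV).trans_le hcard
  · obtain ⟨f, x, hx, y, ⟨-, hy⟩, hxy⟩ := exists_isLink_of_ssubset hG (singleton_subset_iff.2 hv)
      (by simp) hss hne
    have hfv : f ∉ G.incidenceSet v := fun hfv ↦ by
      obtain rfl | rfl := Inc.eq_or_eq_of_isLink hfv hxy
      · exact (hS hx).2 rfl
      · exact hy (Or.inr rfl)
    have honce : f ∈ edgesMeetingOnce G F S :=
      mem_edgesMeetingOnce_of_isLink ⟨hxy.edge_mem, hfv⟩ hxy hx fun hyS ↦ hy (Or.inl hyS)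
    have hpos := (ncard_pos (hE.sdiff.subset fun _ h ↦ h.1)).2 ⟨f, honce⟩
    have hdouble := two_mul_ncard_add_ncard_edgesMeetingOnce_le (F := F) hE.sdiff
      (hV.sdiff.subset hS) fun x hx ↦ edgeSet_sdiff_incidenceSet_inter (G := G) ▸ hdeg x (hS hx)
    omega

/-- The neighbours of `x`, not counting `x` itself when there is a loop at `x`. Distinct neighbours
give distinct edges at `x`, which turns connectivity into a lower bound for the edges at `x`. -/
def neighborSet (G : Graph α β) (x : α) : Set α :=
  {y | y ≠ x ∧ G.Adj x y}

lemma le_encard_neighborSet (hG : G.IsVertexConnected n) (hx : x ∈ V(G)) :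
    n ≤ (neighborSet G x).encard := by
  by_contra! hlt
  have hNV : neighborSet G x ⊆ V(G) := fun _ hy ↦ hy.2.right_mem
  have hss : {x} ⊂ V(G) \ neighborSet G x := by
    have hxN : x ∈ V(G) \ neighborSet G x := ⟨hx, fun h ↦ h.1 rfl⟩
    refine (singleton_subset_iff.2 hxN).ssubset_of_ne fun heq ↦ ?_
    refine hG.1.not_ge ?_
    rw [← encard_sdiff_add_encard_of_subset hNV, ← heq, encard_singleton, add_comm]
    exact Order.add_one_le_of_lt hlt
  obtain ⟨e, _, hz, y, ⟨-, hy⟩, he⟩ :=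
    exists_isLink_of_ssubset hG hNV hlt hss (singleton_nonempty x)
  obtain rfl := mem_singleton_iff.1 hz
  exact hy (or_iff_not_imp_left.2 fun hyx ↦ ⟨hyx, e, he⟩)

lemma encard_neighborSet_sdiff_singleton_le (hxv : x ≠ v) :
    (neighborSet G x \ {v}).encard ≤ (G.incidenceSet x \ G.incidenceSet v).encard := by
  choose ε hε using fun y : ↥(neighborSet G x \ {v}) ↦ y.2.1.2
  have hmem (y) : ε y ∈ G.incidenceSet x \ G.incidenceSet v := by
    refine ⟨(hε y).inc_left, fun hv ↦ ?_⟩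
    obtain rfl | hvy := Inc.eq_or_eq_of_isLink hv (hε y)
    · exact hxv rfl
    · exact y.2.2 hvy.symm
  refine Function.Embedding.encard_le ⟨fun y ↦ ⟨ε y, hmem y⟩, fun y z hyz ↦ ?_⟩
  have hεyz : ε y = ε z := congrArg Subtype.val hyz
  exact Subtype.ext ((hε y).right_unique (hεyz ▸ hε z))

lemma le_ncard_incidenceSet_sdiff (hE : E(G).Finite) (hG : G.IsVertexConnected (n + 1))
    (hx : x ∈ V(G)) (hxv : x ≠ v) : n ≤ (G.incidenceSet x \ G.incidenceSet v).ncard := by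
  have hfin := (hE.subset (G.incidenceSet_subset_edgeSet x)).sdiff (t := G.incidenceSet v)
  rw [← Nat.cast_le (α := ℕ∞), hfin.cast_ncard_eq]
  refine le_trans ?_ (encard_neighborSet_sdiff_singleton_le hxv)
  refine (ENat.add_le_add_iff_right ENat.one_ne_top).1 ((le_encard_neighborSet hG hx).trans ?_)
  simpa using encard_le_encard_sdiff_add_encard (neighborSet G x) {v}

lemma finite_edgeSet [G.Simple] (hV : V(G).Finite) : E(G).Finite := by
  refine (hV.biUnion fun x _ ↦ hV.biUnion fun y _ ↦ Subsingleton.finite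
    (s := {e | G.IsLink e x y}) fun e he f hf ↦ IsLink.eq he hf).subset fun e he ↦ ?_
  obtain ⟨x, y, hxy⟩ := G.exists_isLink_of_mem_edgeSet he
  exact mem_biUnion hxy.left_mem (mem_biUnion hxy.right_mem hxy)

lemma adj_of_encard_vertexSet_eq (hG : G.IsVertexConnected n) (hn : V(G).encard = n + 1)
    (hx : x ∈ V(G)) (hy : y ∈ V(G)) (hxy : x ≠ y) : G.Adj x y := by
  have hsub : neighborSet G x ⊆ V(G) \ {x} := fun _ hz ↦ ⟨hz.2.right_mem, hz.1⟩
  have hcard : (V(G) \ {x}).encard = n :=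
    WithTop.add_right_cancel ENat.one_ne_top ((encard_sdiff_singleton_add_one hx).trans hn)
  have heq := (finite_of_encard_eq_coe hcard).eq_of_subset_of_encard_le' hsub
    (hcard.trans_le (le_encard_neighborSet hG hx))
  exact (heq.superset ⟨hy, hxy.symm⟩).2

lemma isomorphic_ofSimpleGraph [G.Simple] {V : Type*} {H : SimpleGraph V}
    (φ : G.toSimpleGraph ≃g H) : G.Isomorphic (ofSimpleGraph H) := by
  have hends (e : E(G)) : ∃ p : V(G) × V(G), G.IsLink e p.1 p.2 :=
    have ⟨x, y, hxy⟩ := G.exists_isLink_of_mem_edgeSet e.2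
    ⟨(⟨x, hxy.left_mem⟩, ⟨y, hxy.right_mem⟩), hxy⟩
  choose p hp using hends
  have hiff (e : E(G)) (x y : V(G)) :
      G.IsLink e x y ↔ s(φ (p e).1, φ (p e).2) = s(φ x, φ y) := by
    rw [(hp e).isLink_iff]
    simp [Subtype.ext_iff]
  let ε (e : E(G)) : E(ofSimpleGraph H) := ⟨s(φ (p e).1, φ (p e).2),
    φ.map_adj_iff.2 ((toSimpleGraph_adj_iff _ _).2 (hp e).adj)⟩
  have hε : Function.Bijective ε := by
    refine ⟨fun e f hef ↦ ?_, fun ⟨q, hq⟩ ↦ ?_⟩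
    · have he := (hiff e _ _).2 ((congrArg Subtype.val hef).trans ((hiff f _ _).1 (hp f)))
      exact Subtype.ext (he.eq (hp f))
    · induction q with | h a b =>
      obtain ⟨x, rfl⟩ := φ.surjective a
      obtain ⟨y, rfl⟩ := φ.surjective b
      obtain ⟨e, he⟩ := (toSimpleGraph_adj_iff x y).1 (φ.map_adj_iff.1 hq)
      exact ⟨⟨e, he.edge_mem⟩, Subtype.ext ((hiff ⟨e, he.edge_mem⟩ x y).1 he)⟩
  refine ⟨φ.toEquiv.trans (Equiv.Set.univ _).symm, Equiv.ofBijective ε hε, fun e x y ↦ ?_⟩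
  exact (hiff e x y).trans ⟨fun h ↦ ⟨h, (ε e).2⟩, fun h ↦ h.1⟩

lemma isomorphic_top_of_ncard_vertexSet_eq [G.Simple] (hG : G.IsVertexConnected n)
    (hn : V(G).ncard = n + 1) :
    G.Isomorphic (ofSimpleGraph (⊤ : SimpleGraph (Fin (n + 1)))) := by
  have : Finite V(G) := finite_of_ncard_ne_zero (by omega)
  have hcard : V(G).encard = n + 1 := by
    rw [← V(G).toFinite.cast_ncard_eq, hn]
    rfl
  have htop : G.toSimpleGraph = ⊤ := by
    ext x y
    rw [toSimpleGraph_adj_iff, SimpleGraph.top_adj]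
    exact ⟨fun h hxy ↦ h.ne (congrArg Subtype.val hxy), fun h ↦
      adj_of_encard_vertexSet_eq hG hcard x.2 y.2 (Subtype.coe_ne_coe.2 h)⟩
  exact isomorphic_ofSimpleGraph
    (htop ▸ SimpleGraph.Iso.completeGraph (Finite.equivFinOfCardEq hn))

lemma add_two_le_ncard_vertexSet [G.Simple] (hV : V(G).Finite) (hG : G.IsVertexConnected n)
    (hK : ¬ G.Isomorphic (ofSimpleGraph (⊤ : SimpleGraph (Fin (n + 1))))) :
    n + 2 ≤ V(G).ncard := by
  have hlt : n < V(G).ncard := by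
    rw [← Nat.cast_lt (α := ℕ∞), hV.cast_ncard_eq]
    exact hG.1
  exact Nat.lt_of_le_of_ne hlt fun h ↦ hK (isomorphic_top_of_ncard_vertexSet_eq hG h.symm)

/-! ### Recovering the vertex stars -/

lemma encard_vertexSet_eq (hE : E(G).Finite) (hV : V(G).Finite)
    (hdeg : ∀ x ∈ V(G), 3 ≤ (G.incidenceSet x).ncard) (hG' : G'.NoIsolated)
    (hM : G.bicircularMatroid = G'.bicircularMatroid) : V(G').encard = V(G).encard := by
  have hEE : E(G) = E(G') := congrArg Matroid.E hM
  have hle : G.bicircularMatroid.eRk E(G) ≤ V(G).encard :=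
    (eRk_le_encard_ends hE).trans (encard_le_encard ends_subset_vertexSet)
  have hge : V(G).encard ≤ G.bicircularMatroid.eRk E(G) :=
    encard_le_eRk_of_forall_two_le hE subset_rfl hV fun x hx ↦ by
      rw [inter_eq_self_of_subset_right (G.incidenceSet_subset_edgeSet x)]
      exact (Nat.le_succ 2).trans (hdeg x hx)
  have hends : G'.bicircularMatroid.eRk E(G') = (G'.ends E(G')).encard :=
    eRk_eq_encard_ends_of_forall_le (hEE ▸ hE) subset_rfl fun e _ ↦ by
      rw [← hM, ← hEE]
      exact hle.trans (encard_le_eRk_edgeSet_sdiff_singleton hE hV hdeg e)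
  rw [← ends_edgeSet hG', ← hends, ← hM, ← hEE]
  exact hle.antisymm hge

lemma incidenceSet_eq_of_subset (hE : E(G).Finite) (hV : V(G).Finite)
    (hM : G.bicircularMatroid = G'.bicircularMatroid) (hVV : V(G').encard = V(G).encard)
    (hrank : (V(G) \ {v}).encard ≤ G.bicircularMatroid.eRk (E(G) \ G.incidenceSet v))
    (hv' : v' ∈ V(G')) (hsub : G'.incidenceSet v' ⊆ G.incidenceSet v) :
    G'.incidenceSet v' = G.incidenceSet v := by
  refine hsub.antisymm fun f hf ↦ ?_
  by_contra hf'
  set F := E(G) \ G.incidenceSet v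
  have hFfin : F.Finite := hE.sdiff
  have hends : G'.ends (insert f F) ⊆ V(G') \ {v'} := by
    rintro x ⟨e, he, hex⟩
    refine ⟨hex.vertex_mem, ?_⟩
    rintro rfl
    obtain rfl | he := he
    · exact hf' hex
    · exact he.2 (hsub hex)
  have hle := calc V(G).encard = (V(G) \ {v}).encard + 1 :=
      (encard_sdiff_singleton_add_one hf.vertex_mem).symm
    _ ≤ G.bicircularMatroid.eRk F + 1 := by gcongr
    _ = G.bicircularMatroid.eRk (insert f F) :=
      (eRk_insert_of_notMem_ends hf fun h ↦ (ends_sdiff_incidenceSet_subset h).2 rfl).symm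
    _ ≤ (G'.ends (insert f F)).encard := by
      rw [hM]
      exact eRk_le_encard_ends (hFfin.insert f)
    _ ≤ (V(G') \ {v'}).encard := encard_le_encard hends
  have hfin' : V(G').Finite := encard_ne_top_iff.1 (hVV ▸ hV.encard_lt_top.ne)
  have hlt : (V(G') \ {v'}).encard < V(G').encard :=
    hfin'.sdiff.encard_lt_encard (sdiff_singleton_ssubset.2 hv')
  exact (hlt.trans_eq hVV).not_ge hle

lemma exists_mem_vertexSet_notMem (hV : V(G).Finite) (hVV : V(G').encard = V(G).encard)
    (hv : v ∈ V(G)) {S' : Set α'} (hS' : S'.encard ≤ (V(G) \ {v}).encard) :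
    ∃ v' ∈ V(G'), v' ∉ S' :=
  not_subset.1 fun hsub ↦ (hV.sdiff.encard_lt_encard (sdiff_singleton_ssubset.2 hv)).not_ge
    (hVV ▸ (encard_le_encard hsub).trans hS')

lemma exists_incidenceSet_eq (hE : E(G).Finite) (hV : V(G).Finite) (hG : G.IsVertexConnected 2)
    (hM : G.bicircularMatroid = G'.bicircularMatroid) (hVV : V(G').encard = V(G).encard)
    (hv : v ∈ V(G))
    (hdeg : ∀ x ∈ V(G) \ {v}, 2 ≤ (G.incidenceSet x \ G.incidenceSet v).ncard)
    (hcard : V(G).ncard ≤ (E(G) \ G.incidenceSet v).ncard) :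
    ∃ v' ∈ V(G'), G'.incidenceSet v' = G.incidenceSet v := by
  have hEE : E(G) = E(G') := congrArg Matroid.E hM
  set F := E(G) \ G.incidenceSet v
  have hle : G.bicircularMatroid.eRk F ≤ (V(G) \ {v}).encard :=
    (eRk_le_encard_ends hE.sdiff).trans (encard_le_encard ends_sdiff_incidenceSet_subset)
  have hends : G'.bicircularMatroid.eRk F = (G'.ends F).encard :=
    eRk_eq_encard_ends_of_forall_le hE.sdiff (hEE ▸ sdiff_subset) fun e _ ↦ by
      rw [← hM]
      exact hle.trans
        (encard_le_eRk_sdiff_incidenceSet_sdiff_singleton hE hG hV hv hdeg hcard e)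
  obtain ⟨v', hv', hv'F⟩ := exists_mem_vertexSet_notMem hV hVV hv
    (hends ▸ hM ▸ hle : (G'.ends F).encard ≤ (V(G) \ {v}).encard)
  refine ⟨v', hv', incidenceSet_eq_of_subset hE hV hM hVV
    (encard_le_eRk_sdiff_incidenceSet hE hV hdeg) hv' fun e he ↦ ?_⟩
  by_contra hev
  exact hv'F ⟨e, ⟨hEE ▸ he.edge_mem, hev⟩, he⟩

lemma exists_incidenceSet_eq_of_forall_ne (hE : E(G).Finite) (hV : V(G).Finite)
    (hM : G.bicircularMatroid = G'.bicircularMatroid) (hVV : V(G').encard = V(G).encard)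
    (hv : v ∈ V(G)) (hinj : InjOn G.incidenceSet V(G))
    (hdeg : ∀ x ∈ V(G) \ {v}, 2 ≤ (G.incidenceSet x \ G.incidenceSet v).ncard)
    (hcard : (E(G) \ G.incidenceSet v).ncard < V(G).ncard)
    (hinc : ∀ u ∈ V(G) \ {v}, ∃ u', G'.incidenceSet u' = G.incidenceSet u) :
    ∃ v' ∈ V(G'), G'.incidenceSet v' = G.incidenceSet v := by
  have hEE : E(G) = E(G') := congrArg Matroid.E hM
  choose φ hφ using fun u : ↥(V(G) \ {v}) ↦ hinc u u.2
  have hrange : (range φ).encard ≤ (V(G) \ {v}).encard := by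
    rw [← image_univ]
    exact (encard_image_le φ univ).trans_eq (encard_univ _)
  obtain ⟨v', hv', hv'φ⟩ := exists_mem_vertexSet_notMem hV hVV hv hrange
  refine ⟨v', hv', incidenceSet_eq_of_subset hE hV hM hVV
    (encard_le_eRk_sdiff_incidenceSet hE hV hdeg) hv' fun e he ↦ ?_⟩
  by_contra hev
  obtain ⟨x, hx, y, hy, hxy, hex, hey⟩ :=
    exists_inc_ne_of_ncard_lt hE hV hv hdeg hcard ⟨hEE ▸ he.edge_mem, hev⟩
  have hex' : e ∈ G'.incidenceSet (φ ⟨x, hx⟩) := hφ ⟨x, hx⟩ ▸ hex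
  have hey' : e ∈ G'.incidenceSet (φ ⟨y, hy⟩) := hφ ⟨y, hy⟩ ▸ hey
  obtain h | h | h := Inc.eq_or_eq_or_eq hex' hey' he
  · exact hxy (hinj hx.1 hy.1 (by rw [← hφ ⟨x, hx⟩, ← hφ ⟨y, hy⟩, h]))
  · exact hv'φ ⟨_, h⟩
  · exact hv'φ ⟨_, h⟩

lemma stronglyIsomorphic_of_equiv (hE : E(G) = E(G')) (ν : V(G) ≃ V(G'))
    (hν : ∀ x, G'.incidenceSet (ν x) = G.incidenceSet x) : G.StronglyIsomorphic G' := by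
  have hinc (e : β) (x : V(G)) : G'.Inc e (ν x) ↔ G.Inc e x := Set.ext_iff.1 (hν x) e
  refine ⟨hE, ν, fun e x y ↦ ?_⟩
  rw [isLink_iff_inc, isLink_iff_inc, hinc, hinc]
  refine and_congr_right fun _ ↦ and_congr_right fun _ ↦ ⟨fun h z hz ↦ ?_, fun h z hz ↦ ?_⟩
  · obtain ⟨w, hw⟩ := ν.surjective ⟨z, hz.vertex_mem⟩
    obtain rfl : (ν w : α') = z := congrArg Subtype.val hw
    simpa only [Subtype.coe_inj, ν.injective.eq_iff] using h w ((hinc e w).1 hz)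
  · simpa only [Subtype.coe_inj, ν.injective.eq_iff, Subtype.ext_iff] using
      h (ν ⟨z, hz.vertex_mem⟩) ((hinc e ⟨z, hz.vertex_mem⟩).2 hz)

lemma stronglyIsomorphic_of_forall_exists_incidenceSet_eq (hE : E(G) = E(G')) (hV : V(G).Finite)
    (hVV : V(G').encard = V(G).encard) (hinj : InjOn G.incidenceSet V(G))
    (hinc : ∀ v ∈ V(G), ∃ v' ∈ V(G'), G'.incidenceSet v' = G.incidenceSet v) :
    G.StronglyIsomorphic G' := by
  have hV' : Finite V(G') := encard_ne_top_iff.1 (hVV ▸ hV.encard_lt_top.ne)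
  choose φ hφ hφinc using fun x : V(G) ↦ hinc x x.2
  have hφinj : (fun x ↦ (⟨φ x, hφ x⟩ : V(G'))).Injective := fun x y hxy ↦ by
    have hφxy : φ x = φ y := congrArg Subtype.val hxy
    exact Subtype.ext (hinj x.2 y.2 (by rw [← hφinc x, ← hφinc y, hφxy]))
  have hcard : Nat.card V(G') ≤ Nat.card V(G) := (congrArg ENat.toNat hVV).le
  exact stronglyIsomorphic_of_equiv hE
    (Equiv.ofBijective _ (hφinj.bijective_of_nat_card_le hcard)) hφinc

end BicircularMatroid

open BicircularMatroid Set in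
theorem mainTheorem2_general {α α' β : Type*} (G : Graph α β) (hE : E(G).Finite)
    (hconn : G.IsVertexConnected 2) (hcard : 5 ≤ V(G).ncard)
    (hdeg : ∀ x ∈ V(G), ∀ v ∈ V(G), x ≠ v → 2 ≤ (G.incidenceSet x \ G.incidenceSet v).ncard)
    (G' : Graph α' β) (hiso : G'.NoIsolated) (hM : G.bicircularMatroid = G'.bicircularMatroid) :
    G.StronglyIsomorphic G' := by
  have hV : V(G).Finite := finite_of_ncard_pos (by omega)
  have hdeg' (v : α) (hv : v ∈ V(G)) :
      ∀ x ∈ V(G) \ {v}, 2 ≤ (G.incidenceSet x \ G.incidenceSet v).ncard :=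
    fun x hx ↦ hdeg x hx.1 v hv hx.2
  have hthree : ∀ x ∈ V(G), 3 ≤ (G.incidenceSet x).ncard := fun x hx ↦
    three_le_ncard_incidenceSet hE (isVertexConnected_mono one_le_two hconn) (hdeg x hx) hx
  have hVV : V(G').encard = V(G).encard := encard_vertexSet_eq hE hV hthree hiso hM
  have hinj : InjOn G.incidenceSet V(G) := fun x hx v hv heq ↦ by
    by_contra hne
    simpa [heq] using hdeg x hx v hv hne
  have hrich : ∀ v ∈ V(G), V(G).ncard ≤ (E(G) \ G.incidenceSet v).ncard →
      ∃ v' ∈ V(G'), G'.incidenceSet v' = G.incidenceSet v := fun v hv ↦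
    exists_incidenceSet_eq hE hV hconn hM hVV hv (hdeg' v hv)
  refine stronglyIsomorphic_of_forall_exists_incidenceSet_eq (congrArg Matroid.E hM) hV hVV hinj
    fun v hv ↦ ?_
  obtain hle | hlt := le_or_gt V(G).ncard (E(G) \ G.incidenceSet v).ncard
  · exact hrich v hv hle
  · refine exists_incidenceSet_eq_of_forall_ne hE hV hM hVV hv hinj (hdeg' v hv) hlt
      fun u hu ↦ (hrich u hu.1 ?_).imp fun _ hu' ↦ hu'.2
    exact (ncard_le_ncard_sdiff_incidenceSet_or hE hcard hthree hu.1 hv hu.2).resolve_right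
      hlt.not_ge

/-- Every finite (simple) 3-connected graph `G` that is not isomorphic to `K₄` is uniquely defined
by its bicircular matroid: every multigraph `G'` without isolated vertices that has the same
bicircular matroid is strongly isomorphic to `G`. -/
theorem mainTheorem2 {α α' β : Type*} (G : Graph α β) (hfin : V(G).Finite)
    (hsimple : G.Simple) (hconn : G.IsVertexConnected 3)
    (hK4 : ¬ G.Isomorphic (Graph.ofSimpleGraph (⊤ : SimpleGraph (Fin 4))))
    (G' : Graph α' β) (hiso : G'.NoIsolated)
    (hM : G.bicircularMatroid = G'.bicircularMatroid) :
    G.StronglyIsomorphic G' :=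
  have hE := BicircularMatroid.finite_edgeSet hfin
  mainTheorem2_general G hE (BicircularMatroid.isVertexConnected_mono (Nat.le_succ 2) hconn)
    (BicircularMatroid.add_two_le_ncard_vertexSet hfin hconn hK4)
    (fun _ hx _ _ ↦ BicircularMatroid.le_ncard_incidenceSet_sdiff hE hconn hx) G' hiso hM
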